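/- \textbf{Theorem (The dual of $\mathcal{A}_\sigma(G)$).} Let $G$ be a finitely generated group, $S = S^{-1}$ a finite set of generators, $L\colon G \to \mathbb{N}_0$ the word length with respect to $S$, and $\beta_G(n) = \#\{g \in G : L(g) \le n\}$. Let $\sigma\colon \mathbb{N}_0 \to [1,\infty)$ be a growth function, i.e. monotonically increasing and unbounded, and assume that (i) $\sigma$ is almost submultiplicative: for every $\epsilon > 0$ there is $c > 0$ with $\sigma(n+m) \le c\,\sigma(n)^{1+\epsilon}\sigma(m)^{1+\epsilon}$ for all $n, m \in \mathbb{N}_0$; (ii) $\beta_G \preccurlyeq \sigma$: there are an integer $c \ge 1$ and a real $k \ge 1$ with $\beta_G(n) \le c\,\sigma(cn)^k$ for all $n \in \mathbb{N}_0$. For $R \ge 0$ let $\ell^1_{L,\sigma,R}(G)$ be the Banach space of all $a = (a_g)_{g \in G} \in \mathbb{C}^G$ with $\|a\|_{L,\sigma,R} = \sum_{g \in G} |a_g|\,\sigma(L(g))^R < \infty$, let $\ell^\infty_{L,\sigma,-R}(G)$ be the Banach space of all $b \in \mathbb{C}^G$ with $\|b\|_{\ell^\infty,L,\sigma,-R}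 = \sup_{g \in G} |b_g|\,\sigma(L(g))^{-R} < \infty$, and let $\mathcal{A}_\sigma(G) = \bigcap_{R \ge 0} \ell^1_{L,\sigma,R}(G)$ with the locally convex topology defined by all the norms $\|\cdot\|_{L,\sigma,R}$, $R \ge 0$. For $R \le R'$ one has the restriction maps $\ell^1_{L,\sigma,R}(G)' \to \ell^1_{L,\sigma,R'}(G)'$ and the inclusions $\ell^\infty_{L,\sigma,-R}(G) \subseteq \ell^\infty_{L,\sigma,-R'}(G)$; the locally convex inductive limit of either system is its vector space direct limit with the finest locally convex topology making all canonical maps continuous. Equip $\mathcal{A}_\sigma(G)'$ with the strong topology (uniform convergence on bounded sets). Then: 1. The restriction maps $\ell^1_{L,\sigma,R}(G)' \ni \Phi \mapsto \Phi|_{\mathcal{A}_\sigma(G)}$ induce a linear homeomorphism $$\varinjlim_{R \to \infty} \ell^1_{L,\sigma,R}(G)' \;\cong\; \mathcal{A}_\sigma(G)'.$$ 2. For every $R \ge 0$, the map $b \mapsto \bigl(a \mapsto \sum_{g \in G} b_{g^{-1}} a_g\bigr)$ (with convergent series) is an isometric isomorphism $\ell^\infty_{L,\sigma,-R}(G) \to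 \ell^1_{L,\sigma,R}(G)'$, and these isomorphisms induce a linear homeomorphism $$\varinjlim_{R \to \infty} \ell^\infty_{L,\sigma,-R}(G) \;\cong\; \varinjlim_{R \to \infty} \ell^1_{L,\sigma,R}(G)'.$$ -/

import Mathlib

open scoped NNReal Topology

noncomputable section

namespace GroupGrowth

/-! ### Word length, growth of a group, growth functions -/

/-- The word length of `g` with respect to `S`: the least number of elements of `S` needed to
write `g` as a product (the empty product is `1`). -/
def wordLength {G : Type*} [Group G] (S : Finset G) (g : G) : ℕ :=
  sInf {n : ℕ | ∃ l : List G, (∀ s ∈ l, s ∈ S) ∧ l.prod = g ∧ l.length = n}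

/-- The volume growth `β_G(n)`: the number of group elements of word length at most `n`. -/
def volumeGrowth {G : Type*} [Group G] (S : Finset G) (n : ℕ) : ℕ :=
  Set.ncard {g : G | wordLength S g ≤ n}

/-- A growth function: a monotonically increasing and unbounded map `ℕ → [1, ∞)`. -/
structure GrowthFunction where
  toFun : ℕ → ℝ
  one_le' : ∀ n, 1 ≤ toFun n
  monotone' : Monotone toFun
  unbounded' : ¬ BddAbove (Set.range toFun)

instance : CoeFun GrowthFunction (fun _ => ℕ → ℝ) := ⟨GrowthFunction.toFun⟩

/-- For every `ε > 0` there is `c > 0` with `σ(n + m) ≤ c σ(n)^(1+ε) σ(m)^(1+ε)` for all `n, m`. -/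
def AlmostSubmultiplicative (σ : ℕ → ℝ) : Prop :=
  ∀ ε : ℝ, 0 < ε → ∃ c : ℝ, 0 < c ∧
    ∀ n m : ℕ, σ (n + m) ≤ c * σ n ^ (1 + ε) * σ m ^ (1 + ε)

/-- The relation `τ ≼ τ'`: there are constants `c, k ≥ 1` with `τ(n) ≤ c τ'(c n)^k` for all `n`. -/
def Earlier (τ τ' : ℕ → ℝ) : Prop :=
  ∃ c : ℕ, ∃ k : ℝ, 1 ≤ c ∧ 1 ≤ k ∧ ∀ n : ℕ, τ n ≤ c * τ' (c * n) ^ k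

variable {G : Type*} [Group G] (S : Finset G) (σ : GrowthFunction)

/-- The weight `σ(L(g))^R`. -/
def weight (R : ℝ) (g : G) : ℝ := σ (wordLength S g) ^ R

lemma weight_pos (R : ℝ) (g : G) : 0 < weight S σ R g :=
  Real.rpow_pos_of_pos (lt_of_lt_of_le one_pos (σ.one_le' _)) _

lemma weight_mono {R R' : ℝ} (h : R ≤ R') (g : G) : weight S σ R g ≤ weight S σ R' g :=
  Real.rpow_le_rpow_of_exponent_le (σ.one_le' _) h

/-! ### The weighted `ℓ¹`-spaces -/

/-- The formal series `a = ∑ a_g e_g` (functions `G → ℂ`) with `∑ |a_g| σ(L(g))^R < ∞`. -/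
def ellOneSubmodule (R : ℝ) : Submodule ℂ (G → ℂ) where
  carrier := {a | Summable fun g => ‖a g‖ * weight S σ R g}
  zero_mem' := by simp
  add_mem' {a b} ha hb := by
    refine Summable.of_nonneg_of_le
      (fun g => mul_nonneg (norm_nonneg _) (weight_pos S σ R g).le) (fun g => ?_) (ha.add hb)
    rw [← add_mul]
    exact mul_le_mul_of_nonneg_right (norm_add_le _ _) (weight_pos S σ R g).le
  smul_mem' c a ha := by
    have h : Summable fun g => ‖c‖ * (‖a g‖ * weight S σ R g) := Summable.mul_left _ ha
    simpa [mul_assoc] using h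

/-- The weighted space `ℓ¹_{L,σ,R}(G)`. -/
def EllOne (R : ℝ) : Type _ := ↥(ellOneSubmodule S σ R)

namespace EllOne

variable {R : ℝ}

instance : AddCommGroup (EllOne S σ R) := inferInstanceAs (AddCommGroup ↥(ellOneSubmodule S σ R))
instance : Module ℂ (EllOne S σ R) := inferInstanceAs (Module ℂ ↥(ellOneSubmodule S σ R))
instance : CoeFun (EllOne S σ R) (fun _ => G → ℂ) := ⟨Subtype.val⟩

/-- `‖a‖ = ∑ |a_g| σ(L(g))^R`. -/
instance : Norm (EllOne S σ R) := ⟨fun a => ∑' g, ‖a g‖ * weight S σ R g⟩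

variable {S σ}

@[ext] lemma ext {a b : EllOne S σ R} (h : ∀ g, a g = b g) : a = b := Subtype.ext (funext h)

@[simp] lemma add_apply (a b : EllOne S σ R) (g : G) : (a + b) g = a g + b g := rfl
@[simp] lemma smul_apply (c : ℂ) (a : EllOne S σ R) (g : G) : (c • a) g = c * a g := rfl
@[simp] lemma zero_apply (g : G) : (0 : EllOne S σ R) g = 0 := rfl

lemma summable (a : EllOne S σ R) : Summable fun g => ‖a g‖ * weight S σ R g := a.2

lemma norm_def (a : EllOne S σ R) : ‖a‖ = ∑' g, ‖a g‖ * weight S σ R g := rfl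

lemma term_nonneg (a : EllOne S σ R) (g : G) : 0 ≤ ‖a g‖ * weight S σ R g :=
  mul_nonneg (norm_nonneg _) (weight_pos S σ R g).le

variable (S σ R) in
lemma core : NormedSpace.Core ℂ (EllOne S σ R) where
  norm_nonneg a := tsum_nonneg a.term_nonneg
  norm_smul c a := by
    rw [norm_def, norm_def, ← tsum_mul_left]
    exact tsum_congr fun g => by rw [smul_apply, norm_mul, mul_assoc]
  norm_triangle a b := by
    rw [norm_def, norm_def, norm_def, ← a.summable.tsum_add b.summable]
    refine (a + b).summable.tsum_le_tsum (fun g => ?_) (a.summable.add b.summable)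
    rw [← add_mul]
    exact mul_le_mul_of_nonneg_right (norm_add_le _ _) (weight_pos S σ R g).le
  norm_eq_zero_iff a := by
    constructor
    · intro h
      have h' : HasSum (fun g => ‖a g‖ * weight S σ R g) 0 := h ▸ norm_def a ▸ a.summable.hasSum
      rw [hasSum_zero_iff_of_nonneg a.term_nonneg] at h'
      ext g
      have := congrFun h' g
      simpa [(weight_pos S σ R g).ne'] using this
    · rintro rfl
      simp [norm_def]

instance : NormedAddCommGroup (EllOne S σ R) := NormedAddCommGroup.ofCore (core S σ R)
instance : NormedSpace ℂ (EllOne S σ R) := NormedSpace.ofCore (core S σ R)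

end EllOne

/-- The continuous inclusion `ℓ¹_{L,σ,R'}(G) ⊆ ℓ¹_{L,σ,R}(G)` for `R ≤ R'`. -/
def ellOneIncl {R R' : ℝ} (h : R ≤ R') : EllOne S σ R' →L[ℂ] EllOne S σ R :=
  LinearMap.mkContinuous
    { toFun := fun a => ⟨a, Summable.of_nonneg_of_le
        (fun g => mul_nonneg (norm_nonneg _) (weight_pos S σ R g).le)
        (fun g => mul_le_mul_of_nonneg_left (weight_mono S σ h g) (norm_nonneg _)) a.summable⟩
      map_add' := fun _ _ => rfl
      map_smul' := fun _ _ => rfl } 1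
    (fun a => by
      rw [one_mul]
      exact Summable.tsum_le_tsum
        (fun g => mul_le_mul_of_nonneg_left (weight_mono S σ h g) (norm_nonneg _))
        (EllOne.summable _) a.summable)

@[simp] lemma ellOneIncl_apply {R R' : ℝ} (h : R ≤ R') (a : EllOne S σ R') (g : G) :
    ellOneIncl S σ h a g = a g := rfl

/-! ### The weighted `ℓ^∞`-spaces -/

/-- The formal series `b = ∑ b_g e_g` with `sup_g |b_g| σ(L(g))^R < ∞`. -/
def ellInftySubmodule (R : ℝ) : Submodule ℂ (G → ℂ) where
  carrier := {b | BddAbove (Set.range fun g => ‖b g‖ * weight S σ R g)}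
  zero_mem' := ⟨0, by rintro _ ⟨g, rfl⟩; simp⟩
  add_mem' {a b} ha hb := by
    obtain ⟨C, hC⟩ := ha
    obtain ⟨D, hD⟩ := hb
    refine ⟨C + D, ?_⟩
    rintro _ ⟨g, rfl⟩
    refine le_trans ?_ (add_le_add (hC ⟨g, rfl⟩) (hD ⟨g, rfl⟩))
    rw [← add_mul]
    exact mul_le_mul_of_nonneg_right (norm_add_le _ _) (weight_pos S σ R g).le
  smul_mem' c a ha := by
    obtain ⟨C, hC⟩ := ha
    refine ⟨‖c‖ * C, ?_⟩
    rintro _ ⟨g, rfl⟩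
    have := mul_le_mul_of_nonneg_left (hC ⟨g, rfl⟩) (norm_nonneg c)
    simpa [mul_assoc] using this

/-- The weighted space `ℓ^∞_{L,σ,R}(G)`; the exponent `R` may be negative. -/
def EllInfty (R : ℝ) : Type _ := ↥(ellInftySubmodule S σ R)

namespace EllInfty

variable {R : ℝ}

instance : AddCommGroup (EllInfty S σ R) :=
  inferInstanceAs (AddCommGroup ↥(ellInftySubmodule S σ R))
instance : Module ℂ (EllInfty S σ R) := inferInstanceAs (Module ℂ ↥(ellInftySubmodule S σ R))
instance : CoeFun (EllInfty S σ R) (fun _ => G → ℂ) := ⟨Subtype.val⟩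

/-- `‖b‖ = sup_g |b_g| σ(L(g))^R`. -/
instance : Norm (EllInfty S σ R) := ⟨fun b => ⨆ g, ‖b g‖ * weight S σ R g⟩

variable {S σ}

@[ext] lemma ext {a b : EllInfty S σ R} (h : ∀ g, a g = b g) : a = b := Subtype.ext (funext h)

@[simp] lemma add_apply (a b : EllInfty S σ R) (g : G) : (a + b) g = a g + b g := rfl
@[simp] lemma smul_apply (c : ℂ) (a : EllInfty S σ R) (g : G) : (c • a) g = c * a g := rfl
@[simp] lemma zero_apply (g : G) : (0 : EllInfty S σ R) g = 0 := rfl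

lemma bddAbove (b : EllInfty S σ R) : BddAbove (Set.range fun g => ‖b g‖ * weight S σ R g) := b.2

lemma norm_def (b : EllInfty S σ R) : ‖b‖ = ⨆ g, ‖b g‖ * weight S σ R g := rfl

lemma le_norm (b : EllInfty S σ R) (g : G) : ‖b g‖ * weight S σ R g ≤ ‖b‖ :=
  le_ciSup b.bddAbove g

lemma term_nonneg (b : EllInfty S σ R) (g : G) : 0 ≤ ‖b g‖ * weight S σ R g :=
  mul_nonneg (norm_nonneg _) (weight_pos S σ R g).le

variable (S σ R) in
lemma core : NormedSpace.Core ℂ (EllInfty S σ R) where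
  norm_nonneg b := le_trans (b.term_nonneg 1) (b.le_norm 1)
  norm_smul c b := by
    rw [norm_def, norm_def, Real.mul_iSup_of_nonneg (norm_nonneg c)]
    exact iSup_congr fun g => by rw [smul_apply, norm_mul, mul_assoc]
  norm_triangle a b := by
    refine ciSup_le fun g => le_trans ?_ (add_le_add (a.le_norm g) (b.le_norm g))
    rw [← add_mul]
    exact mul_le_mul_of_nonneg_right (norm_add_le _ _) (weight_pos S σ R g).le
  norm_eq_zero_iff b := by
    constructor
    · intro h
      ext g
      have := le_antisymm (h ▸ b.le_norm g) (b.term_nonneg g)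
      simpa [(weight_pos S σ R g).ne'] using this
    · rintro rfl
      simp [norm_def]

instance : NormedAddCommGroup (EllInfty S σ R) := NormedAddCommGroup.ofCore (core S σ R)
instance : NormedSpace ℂ (EllInfty S σ R) := NormedSpace.ofCore (core S σ R)

end EllInfty

/-- The inclusion `ℓ^∞_{L,σ,R'}(G) ⊆ ℓ^∞_{L,σ,R}(G)` for `R ≤ R'`. -/
def ellInftyIncl {R R' : ℝ} (h : R ≤ R') : EllInfty S σ R' →ₗ[ℂ] EllInfty S σ R where
  toFun b := ⟨b, ‖b‖, by
    rintro _ ⟨g, rfl⟩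
    exact (mul_le_mul_of_nonneg_left (weight_mono S σ h g) (norm_nonneg _)).trans (b.le_norm g)⟩
  map_add' _ _ := rfl
  map_smul' _ _ := rfl

@[simp] lemma ellInftyIncl_apply {R R' : ℝ} (h : R ≤ R') (b : EllInfty S σ R') (g : G) :
    ellInftyIncl S σ h b g = b g := rfl

/-! ### The projective limit `A_σ(G)` -/

/-- The formal series lying in all `ℓ¹_{L,σ,R}(G)`, `R ≥ 0`. -/
def asigmaSubmodule : Submodule ℂ (G → ℂ) := ⨅ R : ℝ≥0, ellOneSubmodule S σ (R : ℝ)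

/-- The space `A_σ(G) = ⋂_{R ≥ 0} ℓ¹_{L,σ,R}(G)`. -/
def Asigma : Type _ := ↥(asigmaSubmodule S σ)

namespace Asigma

instance : AddCommGroup (Asigma S σ) := inferInstanceAs (AddCommGroup ↥(asigmaSubmodule S σ))
instance : Module ℂ (Asigma S σ) := inferInstanceAs (Module ℂ ↥(asigmaSubmodule S σ))
instance : CoeFun (Asigma S σ) (fun _ => G → ℂ) := ⟨Subtype.val⟩

/-- The inclusion `A_σ(G) ⊆ ℓ¹_{L,σ,R}(G)` as a linear map. -/
def inclₗ (R : ℝ≥0) : Asigma S σ →ₗ[ℂ] EllOne S σ (R : ℝ) where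
  toFun a := ⟨a, (Submodule.mem_iInf _).1 a.2 R⟩
  map_add' _ _ := rfl
  map_smul' _ _ := rfl

/-- The projective topology: the one defined by all the norms of `ℓ¹_{L,σ,R}(G)`, `R ≥ 0`. -/
instance : TopologicalSpace (Asigma S σ) :=
  ⨅ R : ℝ≥0, TopologicalSpace.induced (inclₗ S σ R) inferInstance

instance : IsTopologicalAddGroup (Asigma S σ) :=
  topologicalAddGroup_iInf fun R => topologicalAddGroup_induced (inclₗ S σ R)

instance : ContinuousSMul ℂ (Asigma S σ) :=
  continuousSMul_iInf fun R => continuousSMul_induced (inclₗ S σ R)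

/-- The continuous inclusion `A_σ(G) ⊆ ℓ¹_{L,σ,R}(G)`. -/
def incl (R : ℝ≥0) : Asigma S σ →L[ℂ] EllOne S σ (R : ℝ) where
  toLinearMap := inclₗ S σ R
  cont := continuous_iInf_dom (i := R) continuous_induced_dom

@[simp] lemma incl_apply (R : ℝ≥0) (a : Asigma S σ) (g : G) : incl S σ R a g = a g := rfl

end Asigma

/-! ### Locally convex inductive limits -/

section InductiveLimit

variable {ι : Type*} [Preorder ι] [DecidableEq ι] (E : ι → Type*)
  [∀ i, AddCommGroup (E i)] [∀ i, Module ℂ (E i)] [∀ i, TopologicalSpace (E i)]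
  (f : ∀ i j, i ≤ j → E i →ₗ[ℂ] E j)

/-- The inductive limit of a system of locally convex spaces: as a vector space it is the
algebraic direct limit. -/
def LCIndLim : Type _ := Module.DirectLimit E f

namespace LCIndLim

instance : AddCommGroup (LCIndLim E f) := inferInstanceAs (AddCommGroup (Module.DirectLimit E f))
instance : Module ℂ (LCIndLim E f) := inferInstanceAs (Module ℂ (Module.DirectLimit E f))

/-- The canonical map from a member of the system to the inductive limit. -/
def of (i : ι) : E i →ₗ[ℂ] LCIndLim E f := Module.DirectLimit.of ℂ ι E f i

/-- The locally convex inductive limit topology: the finest locally convex vector space topology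
for which all canonical maps are continuous. -/
instance : TopologicalSpace (LCIndLim E f) :=
  sInf {t : TopologicalSpace (LCIndLim E f) |
    (∀ i, Continuous[inferInstance, t] (of E f i)) ∧
    @IsTopologicalAddGroup (LCIndLim E f) t _ ∧
    @ContinuousSMul ℂ (LCIndLim E f) _ _ t ∧
    @LocallyConvexSpace ℝ (LCIndLim E f) _ _ _ _ t}

instance : IsTopologicalAddGroup (LCIndLim E f) :=
  topologicalAddGroup_sInf fun _ ht => ht.2.1

instance : ContinuousSMul ℂ (LCIndLim E f) :=
  continuousSMul_sInf fun _ ht => ht.2.2.1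

instance : LocallyConvexSpace ℝ (LCIndLim E f) :=
  LocallyConvexSpace.sInf fun _ ht => ht.2.2.2

lemma continuous_of (i : ι) : Continuous (of E f i) :=
  continuous_sInf_rng.2 fun _ ht => ht.1 i

/-- The universal property: a linear map to a locally convex space is continuous if and only if
its compositions with all canonical maps are. -/
lemma continuous_iff {V : Type*} [AddCommGroup V] [Module ℂ V] [TopologicalSpace V]
    [IsTopologicalAddGroup V] [ContinuousSMul ℂ V] [LocallyConvexSpace ℝ V]
    (T : LCIndLim E f →ₗ[ℂ] V) : Continuous T ↔ ∀ i, Continuous fun x => T (of E f i x) := by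
  refine ⟨fun h i => h.comp (continuous_of E f i), fun h => ?_⟩
  refine continuous_iff_le_induced.2 (sInf_le ⟨fun i => continuous_induced_rng.2 (h i), ?_, ?_, ?_⟩)
  · exact topologicalAddGroup_induced T
  · exact continuousSMul_induced T
  · exact LocallyConvexSpace.induced (T.restrictScalars ℝ)

end LCIndLim

end InductiveLimit

/-! ### The two inductive systems -/

/-- The inductive limit of the Banach spaces `ℓ¹_{L,σ,R}(G)'` (with their norm topologies) for
`R → ∞`, where the map from index `R` to index `R' ≥ R` restricts functionals along
`ℓ¹_{L,σ,R'}(G) ⊆ ℓ¹_{L,σ,R}(G)`. -/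
abbrev IndLimDual : Type _ :=
  LCIndLim (fun R : ℝ≥0 => StrongDual ℂ (EllOne S σ (R : ℝ)))
    (fun _ _ h => ((ellOneIncl S σ (NNReal.coe_le_coe.2 h)).precomp ℂ).toLinearMap)

/-- The inductive limit of the Banach spaces `ℓ^∞_{L,σ,-R}(G)` for `R → ∞`, along the inclusions
`ℓ^∞_{L,σ,-R}(G) ⊆ ℓ^∞_{L,σ,-R'}(G)` for `R ≤ R'`. -/
abbrev IndLimEllInfty : Type _ :=
  LCIndLim (fun R : ℝ≥0 => EllInfty S σ (-(R : ℝ)))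
    (fun _ _ h => ellInftyIncl S σ (neg_le_neg (NNReal.coe_le_coe.2 h)))

end GroupGrowth

end

/-!
# The dual of `A_σ(G)`

All spaces involved consist of functions on `G`, and a continuous functional on `ℓ¹_{L,σ,R}(G)` or
on `A_σ(G)` is determined by its values `u_g` on the basis vectors `e_g`, because every element is
the sum of its coordinates (`EllOne.hasSum_basisVec`, `Asigma.hasSum_dual_apply`). The functionals
on `ℓ¹_{L,σ,R}(G)` are exactly those with `|u_g| ≤ M σ(L(g))^R`; as `L(g⁻¹) = L(g)`, setting
`u_g = b_{g⁻¹}` gives the isometry `ellInftyEquivDual`. These isometries are compatible with the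
two systems, hence induce a homeomorphism of the inductive limits (`LCIndLim.congr`).

A continuous functional on `A_σ(G)` is bounded by one of the norms, so it extends to one of the
`ℓ¹_{L,σ,R}(G)`. Hence the comparison map `restrictLim` from the inductive limit to `A_σ(G)'` is
bijective, and it is continuous by the universal property.

The essential point is that its inverse is continuous for the strong topology. Let `p` be a
continuous seminorm on the inductive limit, with `p ≤ C_n ‖·‖` on `ℓ¹_{L,σ,n}(G)'`. For a sequence
`c_n > 0` put `w = inf_n (c_n σ(L(·))^n)⁻¹`; the vectors `w(g) e_g` form a bounded subset of
`A_σ(G)`. A functional that is at most `1` in absolute value on this set has, for every `g`, some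
`n` with `|u_g| ≤ 2 c_n σ(L(g))^n`. Group finitely many `g` according to such an `n`: this part of
the functional has `p`-seminorm at most `∑ 2 c_n C_n`. The remaining part is small at a single
index `m`: if `|u_g| ≤ M σ(L(g))^R` and `m ≥ R + 1`, then `|u_g| ≤ c_m σ(L(g))^m` for all but
finitely many `g`, since balls in `G` are finite and `σ` is unbounded. So a fast decaying `c_n`
forces `p ≤ 1` (`seminorm_le_one`), that is, `p` is bounded on the polar of a bounded set.
-/

noncomputable section

namespace GroupGrowth

/-! ### Maps out of inductive limits -/

namespace LCIndLim

variable {ι : Type*} [Preorder ι] [DecidableEq ι] {E E' : ι → Type*}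
  [∀ i, AddCommGroup (E i)] [∀ i, Module ℂ (E i)]
  [∀ i, AddCommGroup (E' i)] [∀ i, Module ℂ (E' i)]
  {f : ∀ i j, i ≤ j → E i →ₗ[ℂ] E j} {f' : ∀ i j, i ≤ j → E' i →ₗ[ℂ] E' j}

lemma exists_of [Nonempty ι] [IsDirectedOrder ι] (x : LCIndLim E f) :
    ∃ i y, of E f i y = x :=
  Module.DirectLimit.exists_of x

/-- The linear map out of an inductive limit induced by a compatible family of linear maps. -/
def lift {V : Type*} [AddCommGroup V] [Module ℂ V] (T : ∀ i, E i →ₗ[ℂ] V)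
    (hT : ∀ i j h x, T j (f i j h x) = T i x) : LCIndLim E f →ₗ[ℂ] V :=
  Module.DirectLimit.lift ℂ ι E f T hT

@[simp] lemma lift_of {V : Type*} [AddCommGroup V] [Module ℂ V] (T : ∀ i, E i →ₗ[ℂ] V)
    (hT : ∀ i j h x, T j (f i j h x) = T i x) (i : ι) (x : E i) :
    lift T hT (of E f i x) = T i x :=
  Module.DirectLimit.lift_of T hT x

/-- The linear equivalence of inductive limits induced by compatible linear equivalences. -/
def congrₗ (e : ∀ i, E i ≃ₗ[ℂ] E' i) (he : ∀ i j h x, e j (f i j h x) = f' i j h (e i x)) :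
    LCIndLim E f ≃ₗ[ℂ] LCIndLim E' f' :=
  Module.DirectLimit.congr e fun i j h => LinearMap.ext fun x => he i j h x

lemma congrₗ_of (e : ∀ i, E i ≃ₗ[ℂ] E' i)
    (he : ∀ i j h x, e j (f i j h x) = f' i j h (e i x)) (i : ι) (x : E i) :
    congrₗ e he (of E f i x) = of E' f' i (e i x) :=
  Module.DirectLimit.congr_apply_of _ _ x

lemma congrₗ_symm_of (e : ∀ i, E i ≃ₗ[ℂ] E' i)
    (he : ∀ i j h x, e j (f i j h x) = f' i j h (e i x)) (i : ι) (x : E' i) :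
    (congrₗ e he).symm (of E' f' i x) = of E f i ((e i).symm x) :=
  Module.DirectLimit.congr_symm_apply_of _ _ x

variable [∀ i, TopologicalSpace (E i)] [∀ i, TopologicalSpace (E' i)]

/-- Compatible linear homeomorphisms between the members of two inductive systems induce a linear
homeomorphism of the locally convex inductive limits. -/
def congr (e : ∀ i, E i ≃L[ℂ] E' i) (he : ∀ i j h x, e j (f i j h x) = f' i j h (e i x)) :
    LCIndLim E f ≃L[ℂ] LCIndLim E' f' where
  toLinearEquiv := congrₗ (fun i => (e i).toLinearEquiv) he
  continuous_toFun :=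
    (continuous_iff E f (congrₗ (fun i => (e i).toLinearEquiv) he).toLinearMap).2 fun i =>
      ((continuous_of E' f' i).comp (e i).continuous).congr fun x =>
        (congrₗ_of (fun i => (e i).toLinearEquiv) he i x).symm
  continuous_invFun :=
    (continuous_iff E' f' (congrₗ (fun i => (e i).toLinearEquiv) he).symm.toLinearMap).2 fun i =>
      ((continuous_of E f i).comp (e i).symm.continuous).congr fun x =>
        (congrₗ_symm_of (fun i => (e i).toLinearEquiv) he i x).symm

lemma congr_of (e : ∀ i, E i ≃L[ℂ] E' i)
    (he : ∀ i j h x, e j (f i j h x) = f' i j h (e i x)) (i : ι) (x : E i) :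
    congr e he (of E f i x) = of E' f' i (e i x) :=
  congrₗ_of (fun i => (e i).toLinearEquiv) he i x

end LCIndLim

variable {G : Type*} [Group G] {S : Finset G} {σ : GrowthFunction}

/-! ### Word length -/

lemma exists_list_prod_eq (hgen : Subgroup.closure (S : Set G) = ⊤) (hsymm : ∀ s ∈ S, s⁻¹ ∈ S)
    (g : G) : ∃ l : List G, (∀ s ∈ l, s ∈ S) ∧ l.prod = g ∧ l.length = wordLength S g := by
  have hne : {n : ℕ | ∃ l : List G, (∀ s ∈ l, s ∈ S) ∧ l.prod = g ∧ l.length = n}.Nonempty := by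
    have hg : g ∈ Submonoid.closure ((S : Set G) ∪ (S : Set G)⁻¹) := by
      rw [← Subgroup.closure_toSubmonoid, hgen]
      exact Subgroup.mem_top g
    obtain ⟨l, hl, rfl⟩ := Submonoid.exists_list_of_mem_closure hg
    refine ⟨l.length, l, fun s hs => ?_, rfl, rfl⟩
    rcases hl s hs with h | h
    · exact h
    · simpa using hsymm _ (Set.mem_inv.1 h)
  exact Nat.sInf_mem hne

lemma wordLength_inv_le (hgen : Subgroup.closure (S : Set G) = ⊤) (hsymm : ∀ s ∈ S, s⁻¹ ∈ S)
    (g : G) : wordLength S g⁻¹ ≤ wordLength S g := by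
  obtain ⟨l, hl, hprod, hlen⟩ := exists_list_prod_eq hgen hsymm g
  refine Nat.sInf_le ⟨(l.map (·⁻¹)).reverse, ?_, ?_, by simpa using hlen⟩
  · intro s hs
    obtain ⟨t, ht, rfl⟩ := List.mem_map.1 (List.mem_reverse.1 hs)
    exact hsymm t (hl t ht)
  · rw [← hprod, List.prod_inv_reverse]

lemma wordLength_inv (hgen : Subgroup.closure (S : Set G) = ⊤) (hsymm : ∀ s ∈ S, s⁻¹ ∈ S)
    (g : G) : wordLength S g⁻¹ = wordLength S g :=
  (wordLength_inv_le hgen hsymm g).antisymm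
    (by simpa using wordLength_inv_le hgen hsymm g⁻¹)

lemma weight_inv (hgen : Subgroup.closure (S : Set G) = ⊤) (hsymm : ∀ s ∈ S, s⁻¹ ∈ S)
    (R : ℝ) (g : G) : weight S σ R g⁻¹ = weight S σ R g := by
  simp only [weight, wordLength_inv hgen hsymm]

lemma finite_wordLength_le (hgen : Subgroup.closure (S : Set G) = ⊤)
    (hsymm : ∀ s ∈ S, s⁻¹ ∈ S) (n : ℕ) : {g : G | wordLength S g ≤ n}.Finite := by
  refine ((List.finite_length_le S n).image fun l => (l.map Subtype.val).prod).subset fun g hg => ?_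
  obtain ⟨l, hl, hprod, hlen⟩ := exists_list_prod_eq hgen hsymm g
  refine ⟨l.attach.map fun s => ⟨s.1, hl s.1 s.2⟩, ?_, ?_⟩
  · simpa [hlen] using hg
  · simpa [List.map_map, Function.comp_def] using hprod

/-- The weight `σ ∘ L` is proper: its sublevel sets are finite. -/
lemma finite_growth_lt (hgen : Subgroup.closure (S : Set G) = ⊤)
    (hsymm : ∀ s ∈ S, s⁻¹ ∈ S) (K : ℝ) : {g : G | σ (wordLength S g) < K}.Finite := by
  obtain ⟨_, ⟨N, rfl⟩, hN⟩ := not_bddAbove_iff.1 σ.unbounded' K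
  refine (finite_wordLength_le hgen hsymm N).subset fun g hg => ?_
  by_contra h
  exact absurd (hN.trans_le (σ.monotone' (not_le.1 h).le)) (not_lt.2 (le_of_lt hg))

lemma growth_pos (n : ℕ) : 0 < σ n := one_pos.trans_le (σ.one_le' n)

lemma weight_neg_mul_weight (R : ℝ) (g : G) : weight S σ (-R) g * weight S σ R g = 1 := by
  rw [weight, weight, ← Real.rpow_add (growth_pos _), neg_add_cancel, Real.rpow_zero]

/-! ### Basis vectors -/

namespace EllOne

variable {R : ℝ}

variable (S σ R) in
open scoped Classical in
/-- The basis vector `e_g` of `ℓ¹_{L,σ,R}(G)`. -/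
def basisVec (g : G) : EllOne S σ R :=
  ⟨Pi.single g 1, summable_of_ne_finset_zero (s := {g}) fun h hh => by
    simp [Pi.single_eq_of_ne (by simpa using hh : h ≠ g)]⟩

open scoped Classical in
lemma basisVec_apply (g h : G) : basisVec S σ R g h = (Pi.single g 1 : G → ℂ) h := rfl

lemma sum_apply {ι : Type*} (s : Finset ι) (a : ι → EllOne S σ R) (g : G) :
    (∑ i ∈ s, a i) g = ∑ i ∈ s, a i g := by
  have := congrFun (map_sum (ellOneSubmodule S σ R).subtype a s) g
  exact this.trans (Finset.sum_apply g s _)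

lemma norm_basisVec (g : G) : ‖basisVec S σ R g‖ = weight S σ R g := by
  classical
  rw [norm_def, tsum_eq_single g fun h hh => by simp [basisVec_apply, Pi.single_eq_of_ne hh]]
  simp [basisVec_apply]

lemma hasSum_basisVec (a : EllOne S σ R) : HasSum (fun g => a g • basisVec S σ R g) a := by
  classical
  -- The norm of the difference from a partial sum over `s` is the tail of the series outside `s`.
  have htail := tendsto_tsum_compl_atTop_zero fun g => ‖a g‖ * weight S σ R g
  rw [HasSum, SummationFilter.unconditional_filter, tendsto_iff_norm_sub_tendsto_zero]
  refine htail.congr fun s => ?_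
  have hcoord : ∀ g, ‖(∑ i ∈ s, a i • basisVec S σ R i - a) g‖ * weight S σ R g
      = (sᶜ : Set G).indicator (fun g => ‖a g‖ * weight S σ R g) g := by
    intro g
    have h1 : (∑ i ∈ s, a i • basisVec S σ R i - a) g
        = (∑ i ∈ s, a i • basisVec S σ R i) g - a g := rfl
    rw [h1, sum_apply]
    by_cases hg : g ∈ s
    · simp [basisVec_apply, Pi.single_apply, hg]
    · simp [basisVec_apply, Pi.single_apply, hg]
  rw [norm_def, tsum_congr hcoord]
  exact tsum_subtype (sᶜ : Set G) fun g => ‖a g‖ * weight S σ R g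

lemma hasSum_dual_apply (φ : StrongDual ℂ (EllOne S σ R)) (a : EllOne S σ R) :
    HasSum (fun g => a g * φ (basisVec S σ R g)) (φ a) := by
  simpa using a.hasSum_basisVec.mapL φ

lemma dual_ext {φ ψ : StrongDual ℂ (EllOne S σ R)}
    (h : ∀ g, φ (basisVec S σ R g) = ψ (basisVec S σ R g)) : φ = ψ := by
  ext a
  refine (hasSum_dual_apply φ a).unique ?_
  simpa only [h] using hasSum_dual_apply ψ a

lemma norm_dual_basisVec_le (φ : StrongDual ℂ (EllOne S σ R)) (g : G) :
    ‖φ (basisVec S σ R g)‖ ≤ ‖φ‖ * weight S σ R g := by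
  simpa only [norm_basisVec] using φ.le_opNorm (basisVec S σ R g)

lemma norm_mul_apply_le {u : G → ℂ} {M : ℝ} (hu : ∀ g, ‖u g‖ ≤ M * weight S σ R g)
    (a : EllOne S σ R) (g : G) : ‖u g * a g‖ ≤ M * (‖a g‖ * weight S σ R g) := by
  rw [norm_mul]
  calc ‖u g‖ * ‖a g‖ ≤ M * weight S σ R g * ‖a g‖ :=
        mul_le_mul_of_nonneg_right (hu g) (norm_nonneg _)
    _ = _ := by ring

lemma summable_mul_apply {u : G → ℂ} {M : ℝ} (hu : ∀ g, ‖u g‖ ≤ M * weight S σ R g)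
    (a : EllOne S σ R) : Summable fun g => u g * a g :=
  .of_norm_bounded (a.summable.mul_left M) (norm_mul_apply_le hu a)

/-- The functional `a ↦ ∑ u_g a_g` on `ℓ¹_{L,σ,R}(G)` given by coefficients with
`|u_g| ≤ M σ(L(g))^R`. -/
def dualOfCoeff (u : G → ℂ) (M : ℝ) (hu : ∀ g, ‖u g‖ ≤ M * weight S σ R g) :
    StrongDual ℂ (EllOne S σ R) :=
  LinearMap.mkContinuous
    { toFun := fun a => ∑' g, u g * a g
      map_add' := fun a b => by
        rw [← (summable_mul_apply hu a).tsum_add (summable_mul_apply hu b)]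
        exact tsum_congr fun g => by rw [add_apply, mul_add]
      map_smul' := fun c a => by
        rw [RingHom.id_apply, smul_eq_mul, ← tsum_mul_left]
        exact tsum_congr fun g => by rw [smul_apply, mul_left_comm] } M
    (fun a => by
      rw [norm_def, ← tsum_mul_left]
      exact tsum_of_norm_bounded (a.summable.mul_left M).hasSum (norm_mul_apply_le hu a))

lemma hasSum_dualOfCoeff {u : G → ℂ} {M : ℝ} (hu : ∀ g, ‖u g‖ ≤ M * weight S σ R g)
    (a : EllOne S σ R) : HasSum (fun g => u g * a g) (dualOfCoeff u M hu a) :=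
  (summable_mul_apply hu a).hasSum

lemma norm_dualOfCoeff_le {u : G → ℂ} {M : ℝ} (hM : 0 ≤ M)
    (hu : ∀ g, ‖u g‖ ≤ M * weight S σ R g) : ‖dualOfCoeff u M hu‖ ≤ M :=
  LinearMap.mkContinuous_norm_le _ hM _

@[simp] lemma dualOfCoeff_basisVec {u : G → ℂ} {M : ℝ} (hu : ∀ g, ‖u g‖ ≤ M * weight S σ R g)
    (g : G) : dualOfCoeff u M hu (basisVec S σ R g) = u g := by
  classical
  refine (hasSum_dualOfCoeff hu _).unique ?_
  convert hasSum_single (f := fun h => u h * basisVec S σ R g h) g fun h hh => by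
    simp [basisVec_apply, Pi.single_eq_of_ne hh]
  simp [basisVec_apply]

end EllOne

/-! ### The dual of a weighted `ℓ¹`-space -/

lemma EllInfty.norm_inv_le (hgen : Subgroup.closure (S : Set G) = ⊤)
    (hsymm : ∀ s ∈ S, s⁻¹ ∈ S) {R : ℝ} (b : EllInfty S σ (-R)) (g : G) :
    ‖b g⁻¹‖ ≤ ‖b‖ * weight S σ R g := by
  have h := mul_le_mul_of_nonneg_right (b.le_norm g⁻¹) (weight_pos S σ R g).le
  rwa [weight_inv hgen hsymm, mul_assoc, weight_neg_mul_weight, mul_one] at h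

/-- The isometric isomorphism `ℓ^∞_{L,σ,-R}(G) ≅ ℓ¹_{L,σ,R}(G)'` that sends `b` to the functional
`a ↦ ∑ b_{g⁻¹} a_g`. -/
def ellInftyEquivDual (hgen : Subgroup.closure (S : Set G) = ⊤) (hsymm : ∀ s ∈ S, s⁻¹ ∈ S)
    (R : ℝ) : EllInfty S σ (-R) ≃ₗᵢ[ℂ] StrongDual ℂ (EllOne S σ R) where
  toFun b := EllOne.dualOfCoeff (fun g => b g⁻¹) ‖b‖ (b.norm_inv_le hgen hsymm)
  map_add' b c := EllOne.dual_ext fun g => by simp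
  map_smul' z b := EllOne.dual_ext fun g => by simp
  invFun φ := ⟨fun g => φ (EllOne.basisVec S σ R g⁻¹), ‖φ‖, by
    rintro _ ⟨g, rfl⟩
    have h := mul_le_mul_of_nonneg_right (EllOne.norm_dual_basisVec_le φ g⁻¹)
      (weight_pos S σ (-R) g).le
    rwa [weight_inv hgen hsymm, mul_assoc, mul_comm (weight S σ R g), weight_neg_mul_weight,
      mul_one] at h⟩
  left_inv b := EllInfty.ext fun g => by
    simp
  right_inv φ := EllOne.dual_ext fun g => by simp
  norm_map' b := by
    refine le_antisymm (EllOne.norm_dualOfCoeff_le (norm_nonneg b) (b.norm_inv_le hgen hsymm)) (ciSup_le fun g => ?_)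
    -- Testing the functional on `e_{g⁻¹}` recovers the coefficient `b_g`.
    have h := EllOne.norm_dual_basisVec_le
      (EllOne.dualOfCoeff (fun g => b g⁻¹) ‖b‖ (b.norm_inv_le hgen hsymm)) g⁻¹
    rw [EllOne.dualOfCoeff_basisVec, inv_inv, weight_inv hgen hsymm] at h
    have h' := mul_le_mul_of_nonneg_right h (weight_pos S σ (-R) g).le
    rwa [mul_assoc, mul_comm (weight S σ R g), weight_neg_mul_weight, mul_one] at h'

lemma hasSum_ellInftyEquivDual (hgen : Subgroup.closure (S : Set G) = ⊤)
    (hsymm : ∀ s ∈ S, s⁻¹ ∈ S) (R : ℝ) (b : EllInfty S σ (-R)) (a : EllOne S σ R) :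
    HasSum (fun g => b g⁻¹ * a g) (ellInftyEquivDual hgen hsymm R b a) :=
  EllOne.hasSum_dualOfCoeff (b.norm_inv_le hgen hsymm) a

@[simp] lemma ellInftyEquivDual_basisVec (hgen : Subgroup.closure (S : Set G) = ⊤)
    (hsymm : ∀ s ∈ S, s⁻¹ ∈ S) (R : ℝ) (b : EllInfty S σ (-R)) (g : G) :
    ellInftyEquivDual hgen hsymm R b (EllOne.basisVec S σ R g) = b g⁻¹ :=
  EllOne.dualOfCoeff_basisVec (b.norm_inv_le hgen hsymm) g

/-! ### The space `A_σ(G)` and its dual -/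

namespace Asigma

variable (S σ) in
open scoped Classical in
/-- The basis vector `e_g` of `A_σ(G)`. -/
def basisVec (g : G) : Asigma S σ :=
  ⟨Pi.single g 1, (Submodule.mem_iInf _).2 fun R => (EllOne.basisVec S σ R g).2⟩

@[simp] lemma incl_basisVec (R : ℝ≥0) (g : G) :
    incl S σ R (basisVec S σ g) = EllOne.basisVec S σ R g := rfl

variable (S σ) in
lemma withSeminorms : WithSeminorms (SeminormFamily.sigma fun (R : ℝ≥0) (_ : Fin 1) =>
    (normSeminorm ℂ (EllOne S σ R)).comp (inclₗ S σ R)) :=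
  withSeminorms_iInf fun R => (inclₗ S σ R).withSeminorms_induced
    (norm_withSeminorms ℂ (EllOne S σ R))

lemma isVonNBounded_iff {B : Set (Asigma S σ)} :
    Bornology.IsVonNBounded ℂ B ↔ ∀ R : ℝ≥0, ∃ C > 0, ∀ a ∈ B, ‖incl S σ R a‖ < C := by
  rw [(withSeminorms S σ).isVonNBounded_iff_seminorm_bounded]
  exact ⟨fun h R => h ⟨R, 0⟩, fun h R => h R.1⟩

/-- A continuous functional on `A_σ(G)` is bounded with respect to a single norm, since finitely
many of the norms are dominated by the one with the largest exponent. -/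
lemma exists_bound (f : StrongDual ℂ (Asigma S σ)) :
    ∃ (R : ℝ≥0) (C : ℝ), ∀ a, ‖f a‖ ≤ C * ‖incl S σ R a‖ := by
  obtain ⟨s, C, -, hC⟩ := Seminorm.bound_of_continuous (withSeminorms S σ)
    ((normSeminorm ℂ ℂ).comp f.toLinearMap) (continuous_norm.comp f.continuous)
  refine ⟨s.sup Sigma.fst, C, fun a => (hC a).trans ?_⟩
  rw [smul_apply, NNReal.smul_def, smul_eq_mul]
  refine mul_le_mul_of_nonneg_left ?_ C.2
  refine Seminorm.finset_sup_apply_le (norm_nonneg _) fun i hi => ?_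
  exact Summable.tsum_le_tsum (fun g => mul_le_mul_of_nonneg_left
    (weight_mono S σ (NNReal.coe_le_coe.2 (Finset.le_sup (f := Sigma.fst) hi)) g) (norm_nonneg _))
    (EllOne.summable _) (EllOne.summable _)

lemma hasSum_dual_apply (f : StrongDual ℂ (Asigma S σ)) (a : Asigma S σ) :
    HasSum (fun g => a g * f (basisVec S σ g)) (f a) := by
  obtain ⟨R, C, hC⟩ := exists_bound f
  have h := (tendsto_iff_norm_sub_tendsto_zero.1
    (EllOne.hasSum_basisVec (incl S σ R a))).const_mul C
  rw [mul_zero] at h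
  refine tendsto_iff_norm_sub_tendsto_zero.2 (squeeze_zero (fun _ => norm_nonneg _) (fun s => ?_) h)
  simpa using hC (∑ g ∈ s, a g • basisVec S σ g - a)

lemma dual_ext {f f' : StrongDual ℂ (Asigma S σ)}
    (h : ∀ g, f (basisVec S σ g) = f' (basisVec S σ g)) : f = f' := by
  ext a
  refine (hasSum_dual_apply f a).unique ?_
  simpa only [h] using hasSum_dual_apply f' a

/-- Every continuous functional on `A_σ(G)` extends to some `ℓ¹_{L,σ,R}(G)`. -/
lemma exists_extension (f : StrongDual ℂ (Asigma S σ)) :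
    ∃ (R : ℝ≥0) (φ : StrongDual ℂ (EllOne S σ (R : ℝ))), ∀ a, φ (incl S σ R a) = f a := by
  obtain ⟨R, C, hC⟩ := exists_bound f
  have hu : ∀ g, ‖f (basisVec S σ g)‖ ≤ C * weight S σ R g := fun g => by
    simpa only [incl_basisVec, EllOne.norm_basisVec] using hC (basisVec S σ g)
  refine ⟨R, EllOne.dualOfCoeff _ C hu, fun a => ?_⟩
  refine (EllOne.hasSum_dualOfCoeff hu (incl S σ R a)).unique ?_
  simpa only [incl_apply, mul_comm] using hasSum_dual_apply f a

end Asigma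

/-! ### The comparison map -/

lemma ellOneIncl_incl {R R' : ℝ≥0} (h : R ≤ R') (a : Asigma S σ) :
    ellOneIncl S σ (NNReal.coe_le_coe.2 h) (Asigma.incl S σ R' a) = Asigma.incl S σ R a := rfl

variable (S σ) in
/-- Restriction of functionals from `ℓ¹_{L,σ,R}(G)` to `A_σ(G)`. -/
def restrictDual (R : ℝ≥0) :
    StrongDual ℂ (EllOne S σ (R : ℝ)) →L[ℂ] StrongDual ℂ (Asigma S σ) :=
  (Asigma.incl S σ R).precomp ℂ

@[simp] lemma restrictDual_apply (R : ℝ≥0) (φ : StrongDual ℂ (EllOne S σ (R : ℝ)))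
    (a : Asigma S σ) : restrictDual S σ R φ a = φ (Asigma.incl S σ R a) := rfl

lemma restrictDual_compatible (R R' : ℝ≥0) (h : R ≤ R')
    (φ : StrongDual ℂ (EllOne S σ (R : ℝ))) :
    restrictDual S σ R' ((ellOneIncl S σ (NNReal.coe_le_coe.2 h)).precomp ℂ φ)
      = restrictDual S σ R φ :=
  ContinuousLinearMap.ext fun a => congrArg φ (ellOneIncl_incl h a)

variable (S σ) in
/-- The linear map `lim ℓ¹_{L,σ,R}(G)' → A_σ(G)'` given by restriction of functionals. -/
def restrictLim : IndLimDual S σ →ₗ[ℂ] StrongDual ℂ (Asigma S σ) :=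
  LCIndLim.lift (fun R => (restrictDual S σ R).toLinearMap) restrictDual_compatible

@[simp] lemma restrictLim_of (R : ℝ≥0) (φ : StrongDual ℂ (EllOne S σ (R : ℝ))) :
    restrictLim S σ (LCIndLim.of _ _ R φ) = restrictDual S σ R φ :=
  LCIndLim.lift_of (fun R => (restrictDual S σ R).toLinearMap) restrictDual_compatible R φ

variable (S σ) in
lemma continuous_restrictLim : Continuous (restrictLim S σ) :=
  (LCIndLim.continuous_iff _ _ _).2 fun R =>
    (restrictDual S σ R).continuous.congr fun φ => (restrictLim_of R φ).symm

variable (S σ) in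
lemma restrictLim_injective : Function.Injective (restrictLim S σ) := by
  rw [injective_iff_map_eq_zero]
  intro x hx
  obtain ⟨R, φ, rfl⟩ := LCIndLim.exists_of x
  rw [restrictLim_of] at hx
  have : φ = 0 := EllOne.dual_ext fun g => DFunLike.congr_fun hx (Asigma.basisVec S σ g)
  rw [this, map_zero]

variable (S σ) in
lemma restrictLim_surjective : Function.Surjective (restrictLim S σ) := fun f =>
  let ⟨R, φ, h⟩ := Asigma.exists_extension f
  ⟨LCIndLim.of _ _ R φ, (restrictLim_of R φ).trans (ContinuousLinearMap.ext h)⟩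

/-- Elements of the inductive limit are determined by their coefficients, whichever indices they
come from. -/
lemma indLimDual_ext {x y : IndLimDual S σ} (h : ∀ g, restrictLim S σ x (Asigma.basisVec S σ g)
    = restrictLim S σ y (Asigma.basisVec S σ g)) : x = y :=
  restrictLim_injective S σ (Asigma.dual_ext h)

/-! ### Strong neighbourhoods and the topology of the inductive limit -/

variable (S σ) in
/-- The function `w = inf_n (c_n σ(L(·))^n)⁻¹` on the group. For positive `c_n` it decays faster
than every power of `σ ∘ L`. -/
def decay (c : ℕ → ℝ) (g : G) : ℝ := ⨅ n : ℕ, (c n * weight S σ n g)⁻¹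

lemma decay_nonneg {c : ℕ → ℝ} (hc : ∀ n, 0 < c n) (g : G) : 0 ≤ decay S σ c g :=
  Real.iInf_nonneg fun n => (inv_pos.2 (mul_pos (hc n) (weight_pos S σ n g))).le

lemma decay_mul_weight_le {c : ℕ → ℝ} (hc : ∀ n, 0 < c n) (n : ℕ) (g : G) :
    decay S σ c g * weight S σ n g ≤ (c n)⁻¹ := by
  have hpos := fun n => mul_pos (hc n) (weight_pos S σ n g)
  have h : decay S σ c g ≤ (c n * weight S σ n g)⁻¹ :=
    ciInf_le ⟨0, by rintro _ ⟨k, rfl⟩; exact (inv_pos.2 (hpos k)).le⟩ n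
  rw [mul_inv, ← div_eq_mul_inv, le_div_iff₀ (weight_pos S σ n g)] at h
  exact h

/-- The multiples `w(g) e_g` of the basis vectors form a bounded subset of `A_σ(G)`, since their
norm with exponent `R` is `w(g) σ(L(g))^R`, which is at most `c_n⁻¹` for any `n ≥ R`. -/
lemma isVonNBounded_range_decay {c : ℕ → ℝ} (hc : ∀ n, 0 < c n) :
    Bornology.IsVonNBounded ℂ
      (Set.range fun g => (decay S σ c g : ℂ) • Asigma.basisVec S σ g) := by
  refine Asigma.isVonNBounded_iff.2 fun R => ?_
  obtain ⟨n, hn⟩ := exists_nat_ge (R : ℝ)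
  refine ⟨(c n)⁻¹ + 1, add_pos (inv_pos.2 (hc n)) one_pos, ?_⟩
  rintro _ ⟨g, rfl⟩
  rw [map_smul, norm_smul, Asigma.incl_basisVec, EllOne.norm_basisVec, Complex.norm_real,
    Real.norm_of_nonneg (decay_nonneg hc g)]
  calc decay S σ c g * weight S σ R g ≤ decay S σ c g * weight S σ n g :=
        mul_le_mul_of_nonneg_left (weight_mono S σ hn g) (decay_nonneg hc g)
    _ ≤ (c n)⁻¹ := decay_mul_weight_le hc n g
    _ < _ := lt_add_one _

/-- The factor `2` makes up for the infimum in `decay` not being attained in general. -/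
lemma exists_le_of_mul_decay_le {c : ℕ → ℝ} (hc : ∀ n, 0 < c n) {g : G} {x : ℝ} (hx : 0 ≤ x)
    (h : x * decay S σ c g ≤ 1) : ∃ n : ℕ, x ≤ 2 * c n * weight S σ n g := by
  by_contra! hlt
  have hpos := fun n => mul_pos (hc n) (weight_pos S σ n g)
  have hx' : 0 < x := lt_trans (by linarith [hpos 0]) (hlt 0)
  have hle : 2 / x ≤ decay S σ c g := le_ciInf fun n => by
    rw [← one_div, div_le_div_iff₀ hx' (hpos n)]
    linarith [hlt n]
  have := mul_le_mul_of_nonneg_left hle hx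
  rw [mul_div_cancel₀ _ hx'.ne'] at this
  linarith

/-- Coefficients of growth `σ^R` are small with respect to `σ^m`, `m ≥ R + 1`, away from a finite
set. -/
lemma finite_not_mul_weight_le (hgen : Subgroup.closure (S : Set G) = ⊤)
    (hsymm : ∀ s ∈ S, s⁻¹ ∈ S) {R m M c : ℝ} (hm : R + 1 ≤ m) (hc : 0 < c) :
    {g : G | ¬ M * weight S σ R g ≤ c * weight S σ m g}.Finite := by
  refine (finite_growth_lt (σ := σ) hgen hsymm (M / c)).subset fun g hg => ?_
  contrapose! hg
  simp only [Set.mem_ofPred_eq, not_lt] at hg ⊢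
  rw [div_le_iff₀ hc] at hg
  calc M * weight S σ R g ≤ σ (wordLength S g) * c * weight S σ R g :=
        mul_le_mul_of_nonneg_right hg (weight_pos S σ R g).le
    _ = c * weight S σ (R + 1) g := by
        rw [weight, weight, Real.rpow_add_one (growth_pos _).ne']; ring
    _ ≤ _ := mul_le_mul_of_nonneg_left (weight_mono S σ hm g) hc.le

variable (S σ) in
/-- The canonical map `ℓ¹_{L,σ,n}(G)' → lim ℓ¹_{L,σ,R}(G)'` at a natural number `n`. -/
def ofNat (n : ℕ) : StrongDual ℂ (EllOne S σ (n : ℝ)) →ₗ[ℂ] IndLimDual S σ :=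
  LCIndLim.of (fun R : ℝ≥0 => StrongDual ℂ (EllOne S σ (R : ℝ)))
    (fun _ _ h => ((ellOneIncl S σ (NNReal.coe_le_coe.2 h)).precomp ℂ).toLinearMap) (n : ℝ≥0)

lemma restrictLim_ofNat_basisVec (n : ℕ) (φ : StrongDual ℂ (EllOne S σ (n : ℝ))) (g : G) :
    restrictLim S σ (ofNat S σ n φ) (Asigma.basisVec S σ g) = φ (EllOne.basisVec S σ n g) :=
  DFunLike.congr_fun (restrictLim_of (n : ℝ≥0) φ) (Asigma.basisVec S σ g)

lemma exists_seminorm_ofNat_le {p : Seminorm ℂ (IndLimDual S σ)} (hp : Continuous p) (n : ℕ) :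
    ∃ C > 0, ∀ φ, p (ofNat S σ n φ) ≤ C * ‖φ‖ :=
  Seminorm.bound_of_continuous_normedSpace (p.comp (ofNat S σ n))
    (hp.comp (LCIndLim.continuous_of _ _ (n : ℝ≥0)))

/-- If `c_n` decays fast enough, a continuous seminorm `p` on the inductive limit is at most `1` on
the polar of the bounded set of all `w(g) e_g`. -/
lemma seminorm_le_one (hgen : Subgroup.closure (S : Set G) = ⊤) (hsymm : ∀ s ∈ S, s⁻¹ ∈ S)
    {p : Seminorm ℂ (IndLimDual S σ)} {C : ℕ → ℝ} (hC0 : ∀ n, 0 < C n)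
    (hC : ∀ n φ, p (ofNat S σ n φ) ≤ C n * ‖φ‖) {c : ℕ → ℝ}
    (hc : ∀ n, c n = (1 / 2) ^ n / (8 * C n)) {x : IndLimDual S σ}
    (hx : ∀ g, ‖restrictLim S σ x (Asigma.basisVec S σ g)‖ * decay S σ c g ≤ 1) : p x ≤ 1 := by
  classical
  have hc0 : ∀ n, 0 < c n := fun n => by rw [hc]; have := hC0 n; positivity
  set u : G → ℂ := fun g => restrictLim S σ x (Asigma.basisVec S σ g) with hu_def
  obtain ⟨R, M, hM⟩ : ∃ R M : ℝ, ∀ g, ‖u g‖ ≤ M * weight S σ R g := by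
    obtain ⟨R, φ, rfl⟩ := LCIndLim.exists_of x
    refine ⟨R, ‖φ‖, fun g => ?_⟩
    rw [hu_def, restrictLim_of]
    exact EllOne.norm_dual_basisVec_le φ g
  choose k hk using fun g => exists_le_of_mul_decay_le hc0 (norm_nonneg (u g)) (hx g)
  obtain ⟨m, hm⟩ := exists_nat_ge (R + 1)
  have hfin := finite_not_mul_weight_le (σ := σ) (M := M) hgen hsymm hm (hc0 m)
  -- Away from the finite set `F`, the coefficients `u` are small at the index `m`.
  set F : Finset G := hfin.toFinset with hF
  -- Cutting the coefficients down to a set where they are at most `2 c_n σ^n` gives a functional at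
  -- index `n` with `p`-seminorm at most `2 c_n C_n = 2⁻ⁿ / 4`.
  have hpart : ∀ (n : ℕ) (P : G → Prop), (∀ g, P g → ‖u g‖ ≤ 2 * c n * weight S σ n g) →
      ∃ φ : StrongDual ℂ (EllOne S σ (n : ℝ)),
        (∀ g, φ (EllOne.basisVec S σ n g) = if P g then u g else 0) ∧
        p (ofNat S σ n φ) ≤ (1 / 2) ^ n / 4 := by
    intro n P hP
    have hcn : 0 ≤ 2 * c n := by linarith [hc0 n]
    have hbd : ∀ g, ‖if P g then u g else 0‖ ≤ 2 * c n * weight S σ n g := fun g => by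
      split_ifs with h
      · exact hP g h
      · simpa using mul_nonneg hcn (weight_pos S σ n g).le
    refine ⟨EllOne.dualOfCoeff _ _ hbd, fun g => EllOne.dualOfCoeff_basisVec hbd g, ?_⟩
    calc p (ofNat S σ n (EllOne.dualOfCoeff _ _ hbd))
        ≤ C n * (2 * c n) := (hC n _).trans
          (mul_le_mul_of_nonneg_left (EllOne.norm_dualOfCoeff_le hcn hbd) (hC0 n).le)
      _ = (1 / 2) ^ n / 4 := by
          rw [hc]; field_simp [(hC0 n).ne']; ring
  obtain ⟨ψ, hψ, hpψ⟩ := hpart m (· ∉ F) fun g hg => by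
    have hg' : M * weight S σ R g ≤ c m * weight S σ m g := by simpa [hF] using hg
    have := mul_pos (hc0 m) (weight_pos S σ m g)
    linarith [hM g]
  choose φ hφ hpφ using fun n => hpart n (fun g => g ∈ F ∧ k g = n) fun g hg => hg.2 ▸ hk g
  -- The points of `F` are grouped by an index at which their coefficient is small. The two sides
  -- below live at different indices; they agree because their coefficients do.
  have hxsum : x = ofNat S σ m ψ + ∑ n ∈ F.image k, ofNat S σ n (φ n) := by
    refine indLimDual_ext fun g => ?_
    rw [map_add, map_sum, add_apply, sum_apply]
    simp only [restrictLim_ofNat_basisVec, hψ, hφ]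
    by_cases hg : g ∈ F
    · simp only [hg, not_true_eq_false, if_false, true_and, zero_add]
      rw [Finset.sum_ite_eq, if_pos (Finset.mem_image_of_mem k hg)]
    · simp [hg, u]
  have hsum : ∑ n ∈ F.image k, p (ofNat S σ n (φ n)) ≤ 1 / 2 := by
    calc ∑ n ∈ F.image k, p (ofNat S σ n (φ n))
        ≤ ∑ n ∈ F.image k, (1 / 2 : ℝ) ^ n / 4 := Finset.sum_le_sum fun n _ => hpφ n
      _ = (∑ n ∈ F.image k, (1 / 2 : ℝ) ^ n) / 4 := by rw [Finset.sum_div]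
      _ ≤ 2 / 4 := by
          gcongr
          exact (summable_geometric_two.sum_le_tsum _ fun n _ => by positivity).trans_eq
            tsum_geometric_two
      _ = 1 / 2 := by norm_num
  have hψ4 : p (ofNat S σ m ψ) ≤ 1 / 4 := hpψ.trans <| by
    have : (1 / 2 : ℝ) ^ m ≤ 1 := pow_le_one₀ (by norm_num) (by norm_num)
    linarith
  calc p x ≤ p (ofNat S σ m ψ) + p (∑ n ∈ F.image k, ofNat S σ n (φ n)) := by
        rw [hxsum]; exact map_add_le_add p _ _
    _ ≤ 1 / 4 + 1 / 2 := add_le_add hψ4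
        ((Finset.le_sum_of_subadditive p (map_zero p).le (map_add_le_add p) _ _).trans hsum)
    _ ≤ 1 := by norm_num

/-- Every continuous seminorm on the inductive limit is bounded by `1` on the polar of some bounded
subset of `A_σ(G)`: the inductive limit topology is coarser than the strong topology. -/
lemma exists_isVonNBounded_seminorm_le_one (hgen : Subgroup.closure (S : Set G) = ⊤)
    (hsymm : ∀ s ∈ S, s⁻¹ ∈ S) {p : Seminorm ℂ (IndLimDual S σ)} (hp : Continuous p) :
    ∃ B : Set (Asigma S σ), Bornology.IsVonNBounded ℂ B ∧
      ∀ x, (∀ a ∈ B, ‖restrictLim S σ x a‖ ≤ 1) → p x ≤ 1 := by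
  choose C hC0 hC using exists_seminorm_ofNat_le hp
  have hc0 : ∀ n, 0 < (1 / 2 : ℝ) ^ n / (8 * C n) := fun n => by have := hC0 n; positivity
  refine ⟨_, isVonNBounded_range_decay hc0, fun x hx =>
    seminorm_le_one hgen hsymm hC0 hC (fun _ => rfl) fun g => ?_⟩
  have h := hx _ ⟨g, rfl⟩
  rwa [map_smul, norm_smul, Complex.norm_real, Real.norm_of_nonneg (decay_nonneg hc0 g),
    mul_comm] at h

variable (S σ) in
/-- The comparison map as a linear equivalence. -/
def restrictLimEquiv : IndLimDual S σ ≃ₗ[ℂ] StrongDual ℂ (Asigma S σ) :=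
  .ofBijective (restrictLim S σ) ⟨restrictLim_injective S σ, restrictLim_surjective S σ⟩

open scoped ComplexOrder in
lemma continuous_restrictLimEquiv_symm (hgen : Subgroup.closure (S : Set G) = ⊤)
    (hsymm : ∀ s ∈ S, s⁻¹ ∈ S) : Continuous (restrictLimEquiv S σ).symm := by
  have : ContinuousSMul ℝ (IndLimDual S σ) := IsScalarTower.continuousSMul ℂ
  have : LocallyConvexSpace ℂ (IndLimDual S σ) := ⟨fun x => by
    simpa only [convex_RCLike_iff_convex_real] using LocallyConvexSpace.convex_basis (𝕜 := ℝ) x⟩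
  have hws := with_gaugeSeminormFamily (𝕜 := ℂ) (E := IndLimDual S σ)
  refine WithSeminorms.continuous_of_continuous_comp hws (restrictLimEquiv S σ).symm.toLinearMap
    fun i => ?_
  obtain ⟨B, hB, hle⟩ := exists_isVonNBounded_seminorm_le_one hgen hsymm (hws.continuous_seminorm i)
  refine Seminorm.continuous' (r := 1) ?_
  filter_upwards [ContinuousLinearMap.eventually_nhds_zero_mapsTo hB
    (Metric.closedBall_mem_nhds (0 : ℂ) one_pos)] with f hf
  rw [Seminorm.mem_closedBall_zero]
  refine hle _ fun a ha => ?_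
  have h : restrictLim S σ ((restrictLimEquiv S σ).symm f) = f :=
    (restrictLimEquiv S σ).apply_symm_apply f
  simpa [h] using hf ha

/-- The linear homeomorphism `lim ℓ¹_{L,σ,R}(G)' ≅ A_σ(G)'` given by restriction. -/
def restrictLimHomeo (hgen : Subgroup.closure (S : Set G) = ⊤) (hsymm : ∀ s ∈ S, s⁻¹ ∈ S) :
    IndLimDual S σ ≃L[ℂ] StrongDual ℂ (Asigma S σ) where
  toLinearEquiv := restrictLimEquiv S σ
  continuous_toFun := continuous_restrictLim S σ
  continuous_invFun := continuous_restrictLimEquiv_symm hgen hsymm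

/-! ### The induced isomorphism of inductive limits -/

lemma ellInftyEquivDual_compatible (hgen : Subgroup.closure (S : Set G) = ⊤)
    (hsymm : ∀ s ∈ S, s⁻¹ ∈ S) (R R' : ℝ≥0) (h : R ≤ R') (b : EllInfty S σ (-(R : ℝ))) :
    ellInftyEquivDual hgen hsymm (R' : ℝ)
        (ellInftyIncl S σ (neg_le_neg (NNReal.coe_le_coe.2 h)) b)
      = (ellOneIncl S σ (NNReal.coe_le_coe.2 h)).precomp ℂ
        (ellInftyEquivDual hgen hsymm (R : ℝ) b) :=
  EllOne.dual_ext fun g => by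
    rw [ellInftyEquivDual_basisVec, ellInftyIncl_apply]
    exact (ellInftyEquivDual_basisVec hgen hsymm (R : ℝ) b g).symm

/-- The linear homeomorphism of inductive limits induced by the isomorphisms
`ℓ^∞_{L,σ,-R}(G) ≅ ℓ¹_{L,σ,R}(G)'`. -/
def indLimEllInftyHomeo (hgen : Subgroup.closure (S : Set G) = ⊤) (hsymm : ∀ s ∈ S, s⁻¹ ∈ S) :
    IndLimEllInfty S σ ≃L[ℂ] IndLimDual S σ :=
  LCIndLim.congr
    (fun R : ℝ≥0 => (ellInftyEquivDual hgen hsymm (R : ℝ)).toContinuousLinearEquiv)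
    (ellInftyEquivDual_compatible hgen hsymm)

end GroupGrowth

end

theorem mainTheorem3 {G : Type*} [Group G] (S : Finset G)
    (hgen : Subgroup.closure (S : Set G) = ⊤) (hsymm : ∀ s ∈ S, s⁻¹ ∈ S)
    (σ : GroupGrowth.GrowthFunction) (hσ : GroupGrowth.AlmostSubmultiplicative σ)
    (hβ : GroupGrowth.Earlier (fun n => (GroupGrowth.volumeGrowth S n : ℝ)) σ) :
    ∃ (Ψ : GroupGrowth.IndLimDual S σ ≃L[ℂ] StrongDual ℂ (GroupGrowth.Asigma S σ))
      (J : ∀ R : ℝ≥0, GroupGrowth.EllInfty S σ (-(R : ℝ)) ≃ₗᵢ[ℂ]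
        StrongDual ℂ (GroupGrowth.EllOne S σ (R : ℝ)))
      (Θ : GroupGrowth.IndLimEllInfty S σ ≃L[ℂ] GroupGrowth.IndLimDual S σ),
      (∀ (R : ℝ≥0) (φ : StrongDual ℂ (GroupGrowth.EllOne S σ (R : ℝ)))
        (a : GroupGrowth.Asigma S σ),
        Ψ (GroupGrowth.LCIndLim.of _ _ R φ) a = φ (GroupGrowth.Asigma.incl S σ R a)) ∧
      (∀ (R : ℝ≥0) (b : GroupGrowth.EllInfty S σ (-(R : ℝ)))
        (a : GroupGrowth.EllOne S σ (R : ℝ)),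
        HasSum (fun g : G => b (g⁻¹) * a g) (J R b a)) ∧
      (∀ (R : ℝ≥0) (b : GroupGrowth.EllInfty S σ (-(R : ℝ))),
        Θ (GroupGrowth.LCIndLim.of _ _ R b) = GroupGrowth.LCIndLim.of _ _ R (J R b)) := by
  refine ⟨GroupGrowth.restrictLimHomeo hgen hsymm,
    fun R => GroupGrowth.ellInftyEquivDual hgen hsymm (R : ℝ),
    GroupGrowth.indLimEllInftyHomeo hgen hsymm, fun R φ a => ?_, fun R b a => ?_, fun R b => ?_⟩
  · exact DFunLike.congr_fun (GroupGrowth.restrictLim_of R φ) a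
  · exact GroupGrowth.hasSum_ellInftyEquivDual hgen hsymm (R : ℝ) b a
  · exact GroupGrowth.LCIndLim.congr_of
      (fun R : ℝ≥0 => (GroupGrowth.ellInftyEquivDual hgen hsymm (R : ℝ)).toContinuousLinearEquiv)
      (GroupGrowth.ellInftyEquivDual_compatible hgen hsymm) R b
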